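/- Let $\mathbb Z[x^{\pm 1}]$ be the ring of Laurent polynomials in one variable with integer coefficients, on which the infinite cyclic group $\langle x\rangle$ acts by multiplication. An $\langle x\rangle$-invariant order on $\mathbb Z[x^{\pm 1}]$ is a total order $\leqslant$ on the set $\mathbb Z[x^{\pm 1}]$ such that, whenever $f\leqslant g$, one has $f+h\leqslant g+h$ for all $h\in\mathbb Z[x^{\pm 1}]$ and $q f\leqslant q g$ for all $q\in\langle x\rangle$. Endow the set of all $\langle x\rangle$-invariant orders on $\mathbb Z[x^{\pm 1}]$ with the topology whose sub-basis consists of the sets $V_g=\{\leqslant\ \mid\ 0\leqslant g\}$ for $g\in\mathbb Z[x^{\pm 1}]$. Then this space is homeomorphic to the Cantor set. -/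

import Mathlib

/-- A `Q`-invariant order on `A`, where the group `Q` acts on the abelian group `A` by
automorphisms: a total order `≤` on `A`, compatible with addition and with the action of `Q`. -/
@[ext]
structure InvariantOrder (Q A : Type*) [Group Q] [AddCommGroup A] [DistribMulAction Q A] where
  le : A → A → Prop
  le_refl : ∀ a, le a a
  le_trans : ∀ a b c, le a b → le b c → le a c
  le_antisymm : ∀ a b, le a b → le b a → a = b
  le_total : ∀ a b, le a b ∨ le b a
  add_le_add_right : ∀ a b, le a b → ∀ c, le (a + c) (b + c)
  smul_le_smul : ∀ a b, le a b → ∀ q : Q, le (q • a) (q • b)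

/-- The topology on the space of `Q`-invariant orders on `A` whose sub-basis is the family of the
sets of all orders with `0 ≤ g`, for `g ∈ A`. -/
instance InvariantOrder.instTopologicalSpace (Q A : Type*) [Group Q] [AddCommGroup A]
    [DistribMulAction Q A] : TopologicalSpace (InvariantOrder Q A) :=
  TopologicalSpace.generateFrom (Set.range fun g : A => {o : InvariantOrder Q A | o.le 0 g})

/-- The variable `x` of the Laurent polynomial ring `ℤ[x, x⁻¹]`, as a unit of that ring. -/
noncomputable def laurentX : (LaurentPolynomial ℤ)ˣ where
  val := LaurentPolynomial.T 1
  inv := LaurentPolynomial.T (-1)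
  val_inv := by rw [← LaurentPolynomial.T_add]; simp
  inv_val := by rw [← LaurentPolynomial.T_add]; simp

/-! An order is determined by its nonnegative elements, so the space is compact, Hausdorff, and
separated by the countably many clopen sets `V_g`. By Brouwer's characterization of the Cantor set
(`nonempty_homeomorph_nat_bool`), what remains is that it is nonempty and has no isolated point. As
`x` acts invertibly, it is enough to study cones in `ℤ[X]` and to show that finitely many nonzero
polynomials lying in one cone lie in two (`ShiftCone.exists_ne_forall_mem`).

Up to reversing signs, `1 ≥ 0`. If `X` is infinitely large, signs are those of leading coefficients;
if infinitely small, those of lowest coefficients. In both cases the given polynomials are positive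
on an interval, and evaluation at two transcendental points of it gives two orders. Otherwise `1` is
an order unit, and a Hölder-type uniqueness argument (`exists_monotone_hom_real`) yields evaluation
at some `t > 0`, nonnegative on the cone. If all given polynomials are positive at `t`, they are so
on an interval. If some vanish, these are multiples of one polynomial `m` of positive degree.
Dividing by `m` lowers the total degree, and the two orders obtained by induction are lifted
lexicographically. -/

/-- A set `V` splits `C` when it meets `C` without containing it. -/
def Splits {K : Type*} (V C : Set K) : Prop := (C ∩ V).Nonempty ∧ (C \ V).Nonempty

/-- The least index of a member of the family `U` that splits `C`. -/
noncomputable def splittingIndex {K : Type*} (U : ℕ → Set K) (C : Set K) : ℕ :=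
  sInf {n | Splits (U n) C}

/-- The set obtained from the whole space by cutting `n` times along the first splitting member of
`U`, keeping the side that `b` prescribes. -/
noncomputable def splittingCell {K : Type*} (U : ℕ → Set K) (b : ℕ → Bool) : ℕ → Set K
  | 0 => Set.univ
  | n + 1 =>
    if b n then splittingCell U b n ∩ U (splittingIndex U (splittingCell U b n))
    else splittingCell U b n \ U (splittingIndex U (splittingCell U b n))

/-! ### Brouwer's characterization of the Cantor space. -/

section SplittingCell

variable {K : Type*} {U : ℕ → Set K}

theorem splittingCell_congr {b c : ℕ → Bool} {n : ℕ} (h : ∀ i < n, b i = c i) :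
    splittingCell U b n = splittingCell U c n := by
  induction n with
  | zero => rfl
  | succ n ih =>
    simp only [splittingCell, ih fun i hi => h i (hi.trans n.lt_succ_self), h n n.lt_succ_self]

theorem splittingCell_succ_subset (b : ℕ → Bool) (n : ℕ) :
    splittingCell U b (n + 1) ⊆ splittingCell U b n := by
  rw [splittingCell]
  split_ifs
  · exact Set.inter_subset_left
  · exact Set.sdiff_subset

theorem mem_splittingCell_succ {b : ℕ → Bool} {n : ℕ} {x : K} :
    x ∈ splittingCell U b (n + 1) ↔ x ∈ splittingCell U b n ∧
      (b n = true ↔ x ∈ U (splittingIndex U (splittingCell U b n))) := by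
  rw [splittingCell]
  cases b n <;> simp

theorem not_splits_of_subset {V C D : Set K} (h : C ⊆ D) (hV : ¬ Splits V D) : ¬ Splits V C :=
  fun hC => hV ⟨hC.1.mono (Set.inter_subset_inter_left _ h), hC.2.mono (Set.sdiff_subset_sdiff_left h)⟩

variable [TopologicalSpace K]

theorem splittingCell_isClopen (hU : ∀ n, IsClopen (U n)) (b : ℕ → Bool) (n : ℕ) :
    IsClopen (splittingCell U b n) := by
  induction n with
  | zero => exact isClopen_univ
  | succ n ih =>
    rw [splittingCell]
    split_ifs
    · exact ih.inter (hU _)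
    · exact ih.diff (hU _)

theorem splits_splittingIndex (hsep : ∀ x y : K, x ≠ y → ∃ n, ¬ (x ∈ U n ↔ y ∈ U n))
    (hperf : ∀ W : Set K, IsOpen W → W.Nonempty → W.Nontrivial)
    {C : Set K} (hC : IsOpen C) (hne : C.Nonempty) : Splits (U (splittingIndex U C)) C := by
  refine Nat.sInf_mem (s := {n | Splits (U n) C}) ?_
  obtain ⟨x, hx, y, hy, hxy⟩ := hperf C hC hne
  obtain ⟨n, hn⟩ := hsep x y hxy
  refine ⟨n, ?_⟩
  by_cases hxn : x ∈ U n
  · exact ⟨⟨x, hx, hxn⟩, ⟨y, hy, fun h => hn ⟨fun _ => h, fun _ => hxn⟩⟩⟩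
  · exact ⟨⟨y, hy, by tauto⟩, ⟨x, hx, hxn⟩⟩

theorem splittingCell_nonempty [Nonempty K] (hU : ∀ n, IsClopen (U n))
    (hsep : ∀ x y : K, x ≠ y → ∃ n, ¬ (x ∈ U n ↔ y ∈ U n))
    (hperf : ∀ W : Set K, IsOpen W → W.Nonempty → W.Nontrivial) (b : ℕ → Bool) (n : ℕ) :
    (splittingCell U b n).Nonempty := by
  induction n with
  | zero => exact Set.univ_nonempty
  | succ n ih =>
    have h := splits_splittingIndex hsep hperf (splittingCell_isClopen hU b n).isOpen ih
    rw [splittingCell]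
    split_ifs
    · exact h.1
    · exact h.2

/-- By induction, the least index splitting the `n`-th cell is at least `n`. A set with index `k ≤
n` that still splits this cell is therefore the one used for the next cut. Sets that do not split a
cell do not split its subsets. -/
theorem not_splits_splittingCell [Nonempty K] (hU : ∀ n, IsClopen (U n))
    (hsep : ∀ x y : K, x ≠ y → ∃ n, ¬ (x ∈ U n ↔ y ∈ U n))
    (hperf : ∀ W : Set K, IsOpen W → W.Nonempty → W.Nontrivial) (b : ℕ → Bool) {n k : ℕ}
    (hk : k < n) : ¬ Splits (U k) (splittingCell U b n) := by
  induction n generalizing k with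
  | zero => exact absurd hk k.not_lt_zero
  | succ n ih =>
    by_cases h : Splits (U k) (splittingCell U b n)
    · have hle : splittingIndex U (splittingCell U b n) ≤ k := Nat.sInf_le h
      have hge : n ≤ splittingIndex U (splittingCell U b n) := by
        by_contra! hlt
        exact ih hlt (splits_splittingIndex hsep hperf (splittingCell_isClopen hU b n).isOpen
          (splittingCell_nonempty hU hsep hperf b n))
      have hk' : k = splittingIndex U (splittingCell U b n) := by omega
      rintro ⟨⟨x, hx, hxk⟩, ⟨y, hy, hyk⟩⟩
      rw [mem_splittingCell_succ, ← hk'] at hx hy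
      exact hyk (hy.2.1 (hx.2.2 hxk))
    · exact not_splits_of_subset (splittingCell_succ_subset b n) h

/-- A nonempty compact Hausdorff space without isolated points whose points are separated by
countably many clopen sets is homeomorphic to the Cantor space. -/
theorem nonempty_homeomorph_nat_bool [CompactSpace K] [T2Space K] [Nonempty K]
    (hU : ∀ n, IsClopen (U n))
    (hsep : ∀ x y : K, x ≠ y → ∃ n, ¬ (x ∈ U n ↔ y ∈ U n))
    (hperf : ∀ W : Set K, IsOpen W → W.Nonempty → W.Nontrivial) :
    Nonempty ((ℕ → Bool) ≃ₜ K) := by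
  have hex : ∀ b : ℕ → Bool, (⋂ n, splittingCell U b n).Nonempty := fun b =>
    IsCompact.nonempty_iInter_of_sequence_nonempty_isCompact_isClosed _
      (splittingCell_succ_subset b) (splittingCell_nonempty hU hsep hperf b)
      (splittingCell_isClopen hU b 0).isClosed.isCompact
      fun n => (splittingCell_isClopen hU b n).isClosed
  choose g hg using hex
  simp only [Set.mem_iInter] at hg
  -- No `U k` distinguishes two points of the `k + 1`-st cell, so the cells along `b` intersect in a
  -- single point.
  have hgU : ∀ b k x, x ∈ splittingCell U b (k + 1) → (x ∈ U k ↔ g b ∈ U k) := by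
    intro b k x hx
    have h := not_splits_splittingCell hU hsep hperf b k.lt_succ_self
    by_contra hne
    by_cases hxk : x ∈ U k
    · exact h ⟨⟨x, hx, hxk⟩, ⟨g b, hg b _, fun h => hne ⟨fun _ => h, fun _ => hxk⟩⟩⟩
    · exact h ⟨⟨g b, hg b _, by tauto⟩, ⟨x, hx, hxk⟩⟩
  have huniq : ∀ b x, (∀ n, x ∈ splittingCell U b n) → x = g b := by
    intro b x hx
    by_contra hne
    obtain ⟨k, hk⟩ := hsep _ _ hne
    exact hk (hgU b k x (hx _))
  have hinj : Function.Injective g := by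
    intro b c hbc
    by_contra hne
    obtain ⟨n, hn, hmin⟩ : ∃ n, b n ≠ c n ∧ ∀ i < n, b i = c i := by
      have h : ∃ n, b n ≠ c n := Function.ne_iff.1 hne
      classical
      exact ⟨Nat.find h, Nat.find_spec h, fun i hi => not_not.1 (Nat.find_min h hi)⟩
    have h1 := (mem_splittingCell_succ.1 (hg b (n + 1))).2
    have h2 := (mem_splittingCell_succ.1 (hg c (n + 1))).2
    rw [← hbc, ← splittingCell_congr hmin] at h2
    exact hn (Bool.eq_iff_iff.2 (h1.trans h2.symm))
  have hsurj : Function.Surjective g := by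
    classical
    intro x
    -- The address `b` of `x` and its cells depend on each other; iterating the cut that keeps `x`
    -- defines the cells without `b`.
    let step : Set K → Set K := fun C =>
      if x ∈ U (splittingIndex U C) then C ∩ U (splittingIndex U C)
      else C \ U (splittingIndex U C)
    let C : ℕ → Set K := fun n => step^[n] Set.univ
    let b : ℕ → Bool := fun n => decide (x ∈ U (splittingIndex U (C n)))
    have hC : ∀ n, splittingCell U b n = C n := by
      intro n
      induction n with
      | zero => rfl
      | succ n ih =>
        rw [splittingCell, ih]
        simp only [b, C, Function.iterate_succ_apply', step, decide_eq_true_eq]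
    refine ⟨b, (huniq b x fun n => ?_).symm⟩
    induction n with
    | zero => exact Set.mem_univ x
    | succ n ih =>
      refine mem_splittingCell_succ.2 ⟨ih, ?_⟩
      rw [hC]
      simp [b]
  have hcont : Continuous g := by
    refine continuous_iff_continuousAt.2 fun b W hW => ?_
    -- By compactness some cell lies in `W`, and a cell depends on finitely many coordinates only.
    obtain ⟨n, hn⟩ : ∃ n, splittingCell U b n ⊆ W := by
      refine exists_subset_nhds_of_isCompact
        (directed_of_isDirected_le (antitone_nat_of_succ_le (splittingCell_succ_subset b)))
        (fun n => (splittingCell_isClopen hU b n).isClosed.isCompact) fun x hx => ?_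
      rwa [huniq b x (Set.mem_iInter.1 hx)]
    have hnhds : ∀ᶠ c : ℕ → Bool in nhds b, ∀ i ∈ Set.Iio n, c i = b i :=
      (Filter.eventually_all_finite (Set.finite_Iio n)).2 fun i _ =>
        ((isOpen_discrete {b i}).preimage (continuous_apply i)).mem_nhds (Set.mem_singleton (b i))
    change ∀ᶠ c in nhds b, g c ∈ W
    filter_upwards [hnhds] with c hc
    refine hn ?_
    rw [← splittingCell_congr (fun i hi => hc i hi)]
    exact hg c n
  exact ⟨Continuous.homeoOfEquivCompactToT2 (f := Equiv.ofBijective g ⟨hinj, hsurj⟩) hcont⟩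

end SplittingCell

/-! ### Monotone homomorphisms to the real numbers. -/

/-- A linearly ordered abelian group with an order unit `u` has a monotone homomorphism to `ℝ`
with value `1` at `u`, and every monotone homomorphism to `ℝ` is a multiple of it. -/
theorem exists_monotone_hom_real {M : Type*} [AddCommGroup M] [LinearOrder M]
    [IsOrderedAddMonoid M] {u : M} (hu : 0 < u) (hunit : ∀ f : M, ∃ n : ℕ, f ≤ n • u) :
    ∃ φ : M →+ ℝ, Monotone φ ∧ φ u = 1 ∧
      ∀ ψ : M →+ ℝ, Monotone ψ → ∀ f, ψ f = ψ u * φ f := by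
  -- The lower Dedekind cut of `f` measured in units of `u`; the homomorphism is its supremum.
  let S : M → Set ℝ := fun f => {r | ∃ (a : ℤ) (b : ℕ), 0 < b ∧ a • u ≤ b • f ∧ r = a / b}
  have hmono_smul : ∀ a b : ℤ, a • u ≤ b • u → a ≤ b := fun a b h =>
    (zsmul_le_zsmul_iff_left hu).1 h
  have hbound : ∀ f (n : ℕ), f ≤ n • u → ∀ r ∈ S f, r ≤ n := by
    rintro f n hn r ⟨a, b, hb, hab, rfl⟩
    rw [div_le_iff₀ (by exact_mod_cast hb)]
    have h : a • u ≤ ((n * b : ℕ) : ℤ) • u := by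
      rw [natCast_zsmul, mul_comm, mul_nsmul']
      exact hab.trans (nsmul_le_nsmul_right hn b)
    exact_mod_cast hmono_smul _ _ h
  have hbdd : ∀ f, BddAbove (S f) := fun f => by
    obtain ⟨n, hn⟩ := hunit f
    exact ⟨n, hbound f n hn⟩
  have hne : ∀ f, (S f).Nonempty := fun f => by
    obtain ⟨n, hn⟩ := hunit (-f)
    refine ⟨_, -n, 1, one_pos, ?_, rfl⟩
    rw [neg_zsmul, natCast_zsmul, one_nsmul]
    exact neg_le.1 hn
  have hdich : ∀ f (a : ℤ) (b : ℕ), 0 < b → (a / b : ℝ) ∈ S f ∨ (-(a / b) : ℝ) ∈ S (-f) := by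
    intro f a b hb
    rcases le_total (a • u) (b • f) with h | h
    · exact Or.inl ⟨a, b, hb, h, rfl⟩
    · refine Or.inr ⟨-a, b, hb, ?_, by push_cast; ring⟩
      rw [neg_zsmul, smul_neg]
      exact neg_le_neg h
  let φ : M → ℝ := fun f => sSup (S f)
  have hle : ∀ f, ∀ r ∈ S f, r ≤ φ f := fun f r hr => le_csSup (hbdd f) hr
  have hsuper : ∀ f g, φ f + φ g ≤ φ (f + g) := by
    intro f g
    refine le_of_forall_lt fun c hc => ?_
    obtain ⟨d, hd, hcd⟩ : ∃ d, d < φ f ∧ c - d < φ g := by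
      exact ⟨φ f - (φ f + φ g - c) / 2, by linarith, by linarith⟩
    obtain ⟨r, ⟨a, b, hb, hab, rfl⟩, hr⟩ := exists_lt_of_lt_csSup (hne f) hd
    obtain ⟨s, ⟨a', b', hb', hab', rfl⟩, hs⟩ := exists_lt_of_lt_csSup (hne g) hcd
    refine lt_of_lt_of_le (by linarith : c < (a / b : ℝ) + a' / b') (hle _ _ ?_)
    refine ⟨a * b' + a' * b, b * b', Nat.mul_pos hb hb', ?_, ?_⟩
    · have h1 := nsmul_le_nsmul_right hab b'
      have h2 := nsmul_le_nsmul_right hab' b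
      have h3 := add_le_add h1 h2
      convert h3 using 1 <;> module
    · have : (b : ℝ) ≠ 0 := by exact_mod_cast hb.ne'
      have : (b' : ℝ) ≠ 0 := by exact_mod_cast hb'.ne'
      push_cast
      field_simp
  have hnonneg : ∀ f, 0 ≤ f → 0 ≤ φ f := fun f hf =>
    hle f 0 ⟨0, 1, one_pos, by simpa using hf, by simp⟩
  have hzero : φ 0 = 0 := le_antisymm
    (csSup_le (hne 0) fun r hr => by simpa using hbound 0 0 (by simp) r hr) (hnonneg 0 le_rfl)
  have hneg : ∀ f, φ (-f) = -φ f := by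
    intro f
    have h1 : φ f + φ (-f) ≤ 0 := by simpa [hzero] using hsuper f (-f)
    by_contra hne'
    have hlt : φ f < -φ (-f) := lt_of_le_of_ne (by linarith) fun h => hne' (by linarith)
    -- By `hdich` this rational lies in the cut of `f` or its negative in that of `-f`; both are
    -- impossible.
    obtain ⟨q, hq1, hq2⟩ := exists_rat_btwn hlt
    have hq : (q : ℝ) = q.num / q.den := by exact_mod_cast (Rat.num_div_den q).symm
    rcases hdich f q.num q.den q.den_pos with h | h
    · rw [← hq] at h
      linarith [hle _ _ h]
    · rw [← hq] at h
      linarith [hle _ _ h]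
  have hadd : ∀ f g, φ (f + g) = φ f + φ g := by
    intro f g
    refine le_antisymm ?_ (hsuper f g)
    have h := hsuper (f + g) (-g)
    rw [add_neg_cancel_right, hneg] at h
    linarith
  let Φ : M →+ ℝ := ⟨⟨φ, hzero⟩, hadd⟩
  refine ⟨Φ, fun f g hfg => ?_, ?_, fun ψ hψ f => ?_⟩
  · have h := hnonneg _ (sub_nonneg.2 hfg)
    have h2 : Φ (g - f) = Φ g - Φ f := map_sub Φ g f
    change 0 ≤ Φ (g - f) at h
    linarith
  · exact le_antisymm
      (csSup_le (hne u) fun r hr => by simpa using hbound u 1 (by simp) r hr)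
      (hle u 1 ⟨1, 1, one_pos, by simp, by simp⟩)
  · have hψu : 0 ≤ ψ u := by simpa using hψ hu.le
    -- Applied to `-f` as well, this inequality becomes an equality.
    have key : ∀ f, ψ u * φ f ≤ ψ f := by
      intro f
      rcases hψu.eq_or_lt with h0 | hpos
      · obtain ⟨n, hn⟩ := hunit (-f)
        have h := hψ hn
        simp only [map_neg, map_nsmul, ← h0, smul_zero] at h
        rw [← h0, zero_mul]
        linarith
      · rw [mul_comm, ← le_div_iff₀ hpos]
        refine csSup_le (hne f) ?_
        rintro r ⟨a, b, hb, hab, rfl⟩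
        have hb' : (0 : ℝ) < b := by exact_mod_cast hb
        have h := hψ hab
        simp only [map_nsmul, map_zsmul, zsmul_eq_mul, nsmul_eq_mul] at h
        rw [div_le_div_iff₀ hb' hpos]
        linarith
    refine le_antisymm ?_ (key f)
    have h := key (-f)
    rw [hneg, map_neg] at h
    change ψ f ≤ ψ u * φ f
    linarith

/-! ### Shift-invariant cones of integer polynomials. -/

open Polynomial

/-- The nonnegative part of a total order on `ℤ[X]` that is compatible with addition and with
multiplication by `X`. -/
structure ShiftCone extends AddGroupCone ℤ[X] where
  mem_or_neg_mem' : ∀ f : ℤ[X], f ∈ toAddGroupCone ∨ -f ∈ toAddGroupCone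
  X_mul_mem' : ∀ f : ℤ[X], f ∈ toAddGroupCone → X * f ∈ toAddGroupCone

namespace ShiftCone

instance : SetLike ShiftCone ℤ[X] where
  coe P := P.carrier
  coe_injective P Q h := by
    obtain ⟨P, _, _⟩ := P
    obtain ⟨Q, _, _⟩ := Q
    congr
    exact SetLike.ext' h

instance : AddGroupConeClass ShiftCone ℤ[X] where
  add_mem {P} := P.add_mem'
  zero_mem P := P.zero_mem'
  eq_zero_of_mem_of_neg_mem {P} := P.eq_zero_of_mem_of_neg_mem'

variable (P : ShiftCone)

variable {P} in
theorem X_mul_mem {f : ℤ[X]} (hf : f ∈ P) : X * f ∈ P := P.X_mul_mem' f hf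

instance : HasMemOrNegMem P where
  mem_or_neg_mem := P.mem_or_neg_mem'

/-- A cone of integer polynomials given by a set closed under the relevant operations. -/
def ofSet (S : Set ℤ[X]) (hadd : ∀ f ∈ S, ∀ g ∈ S, f + g ∈ S)
    (hanti : ∀ f ∈ S, -f ∈ S → f = 0) (htotal : ∀ f, f ∈ S ∨ -f ∈ S)
    (hX : ∀ f ∈ S, X * f ∈ S) : ShiftCone where
  carrier := S
  add_mem' {f g} hf hg := hadd f hf g hg
  zero_mem' := by simpa using htotal 0
  eq_zero_of_mem_of_neg_mem' {f} hf hf' := hanti f hf hf'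
  mem_or_neg_mem' := htotal
  X_mul_mem' := hX

variable {P}

theorem X_mul_mem_iff {f : ℤ[X]} : X * f ∈ P ↔ f ∈ P := by
  refine ⟨fun h => ?_, X_mul_mem⟩
  rcases mem_or_neg_mem P f with hf | hf
  · exact hf
  · have h' : -(X * f) ∈ P := by simpa using X_mul_mem hf
    have h0 : X * f = 0 := eq_zero_of_mem_of_neg_mem h h'
    rw [(mul_eq_zero.1 h0).resolve_left X_ne_zero]
    exact zero_mem P

theorem X_pow_mul_mem_iff {f : ℤ[X]} (n : ℕ) : X ^ n * f ∈ P ↔ f ∈ P := by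
  induction n with
  | zero => simp
  | succ n ih => rw [pow_succ', mul_assoc, X_mul_mem_iff, ih]

variable (P) in
/-- The cone with all signs reversed. -/
def neg : ShiftCone :=
  ofSet {f | -f ∈ P} (fun f hf g hg => by simpa [add_comm] using add_mem hf hg)
    (fun f hf hf' => neg_eq_zero.1 (eq_zero_of_mem_of_neg_mem (C := P) hf hf'))
    (fun f => mem_or_neg_mem P (-f)) (fun f hf => by simpa using X_mul_mem_iff.2 hf)

@[simp]
theorem mem_neg {f : ℤ[X]} : f ∈ P.neg ↔ -f ∈ P := Iff.rfl

variable (P) in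
/-- The linear order on `ℤ[X]` with nonnegative part `P`. -/
noncomputable abbrev linearOrder : LinearOrder ℤ[X] :=
  haveI := Classical.decPred (· ∈ P)
  LinearOrder.mkOfAddGroupCone P

variable (P) in
theorem isOrderedAddMonoid : @IsOrderedAddMonoid ℤ[X] _ P.linearOrder.toPartialOrder.toPreorder :=
  IsOrderedAddMonoid.mkOfCone P

theorem X_mul_le_X_mul {f g : ℤ[X]} (h : P.linearOrder.le f g) :
    P.linearOrder.le (X * f) (X * g) := by
  change X * g - X * f ∈ P
  rw [← mul_sub]
  exact X_mul_mem_iff.2 h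

/-- Horner recursion: multiplying by `X` turns a bound `k` into `k • X`, hence into `k * n`. -/
theorem exists_le_nsmul_one (h1 : (1 : ℤ[X]) ∈ P) {n : ℕ} (hn : P.linearOrder.le X (n • 1))
    (f : ℤ[X]) : ∃ k : ℕ, P.linearOrder.le f (k • 1) := by
  let _ := P.linearOrder
  have := P.isOrderedAddMonoid
  have h1' : (0 : ℤ[X]) ≤ 1 := by
    change (1 : ℤ[X]) - 0 ∈ P
    rwa [sub_zero]
  induction f using Polynomial.recOnHorner with
  | M0 => exact ⟨0, by simp⟩
  | MC p a _ _ ih =>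
    obtain ⟨k, hk⟩ := ih
    refine ⟨k + a.natAbs, ?_⟩
    rw [add_nsmul]
    refine add_le_add hk ?_
    have : (C a : ℤ[X]) = a • 1 := by simp
    rw [this, ← natCast_zsmul]
    exact zsmul_le_zsmul_left h1' (by omega)
  | MX p _ ih =>
    obtain ⟨k, hk⟩ := ih
    refine ⟨k * n, ?_⟩
    have h := X_mul_le_X_mul hk
    rw [mul_comm p X, mul_nsmul']
    refine h.trans ?_
    rw [mul_smul_comm, mul_one]
    exact nsmul_le_nsmul_right hn k

/-- If `X` is comparable to `1`, then nonnegative polynomials take nonnegative values at some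
positive real number. -/
theorem exists_forall_aeval_nonneg (h1 : (1 : ℤ[X]) ∈ P) {n : ℕ}
    (hn : P.linearOrder.le X (n • 1)) (hn' : P.linearOrder.le 1 (n • X)) :
    ∃ t : ℝ, 0 < t ∧ ∀ f ∈ P, 0 ≤ aeval t f := by
  have hunit := exists_le_nsmul_one h1 hn
  have hX := @X_mul_le_X_mul P
  have hmem : ∀ f, P.linearOrder.le 0 f ↔ f ∈ P := fun f => by
    change f - 0 ∈ P ↔ _
    rw [sub_zero]
  let _ := P.linearOrder
  have := P.isOrderedAddMonoid
  obtain ⟨φ, hφ, hφ1, huniq⟩ := exists_monotone_hom_real (u := (1 : ℤ[X]))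
    (lt_of_le_of_ne ((hmem 1).2 h1) zero_ne_one) hunit
  -- The map `f ↦ φ (X * f)` is again a monotone homomorphism, so uniqueness makes it a multiple of
  -- `φ`.
  have hshift : ∀ f, φ (X * f) = φ X * φ f := by
    intro f
    have h := huniq (φ.comp (AddMonoidHom.mulLeft X)) (fun f g hfg => hφ (hX hfg)) f
    simpa using h
  have heval : ∀ f, φ f = aeval (φ X) f := by
    intro f
    induction f using Polynomial.recOnHorner with
    | M0 => simp
    | MC p a _ _ ih =>
      have : (C a : ℤ[X]) = a • 1 := by simp
      rw [map_add, map_add, ih, this, map_zsmul, map_zsmul, hφ1, map_one]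
    | MX p _ ih => rw [mul_comm, hshift, ih, map_mul, aeval_X]
  refine ⟨φ X, ?_, fun f hf => ?_⟩
  · have h := hφ hn'
    rw [hφ1, map_nsmul, nsmul_eq_mul] at h
    by_contra! hle
    have : (n : ℝ) * φ X ≤ 0 := mul_nonpos_of_nonneg_of_nonpos n.cast_nonneg hle
    linarith
  · rw [← heval, ← map_zero φ]
    exact hφ ((hmem f).2 hf)

/-- If `X` is infinitely large, then polynomials with positive leading coefficient are positive. -/
theorem mem_of_leadingCoeff_pos (h1 : (1 : ℤ[X]) ∈ P) (hX : ∀ n : ℕ, X - n • 1 ∈ P) {f : ℤ[X]}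
    (hf : 0 < f.leadingCoeff) : f ∈ P := by
  -- The stronger claim feeds the induction: `f.divX ≥ 1` gives `X * f.divX ≥ X`, which absorbs any
  -- constant term.
  suffices h : ∀ f : ℤ[X], 0 < f.leadingCoeff → f - 1 ∈ P by
    simpa using add_mem (h f hf) h1
  intro f hf
  have hnat : ∀ a : ℤ, 0 ≤ a → (C a : ℤ[X]) ∈ P := fun a ha => by
    obtain ⟨n, rfl⟩ := Int.eq_ofNat_of_zero_le ha
    simpa using nsmul_mem h1 n
  induction hd : f.natDegree generalizing f with
  | zero =>
    rw [eq_C_of_natDegree_eq_zero hd] at hf ⊢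
    rw [leadingCoeff_C] at hf
    simpa using hnat (f.coeff 0 - 1) (by omega)
  | succ d ih =>
    have hlead : f.divX.leadingCoeff = f.leadingCoeff := by
      rw [leadingCoeff, leadingCoeff, natDegree_divX_eq_natDegree_tsub_one, hd, coeff_divX]
      rfl
    have h := X_mul_mem_iff.2 (ih f.divX (by rwa [hlead]) (by
      rw [natDegree_divX_eq_natDegree_tsub_one, hd]; rfl))
    have h2 := add_mem h (add_mem (hX (1 + (f.coeff 0).natAbs))
      (hnat (f.coeff 0 + (f.coeff 0).natAbs) (by omega)))
    convert h2 using 1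
    conv_lhs => rw [← X_mul_divX_add f]
    simp
    ring

/-- If `X` is infinitely small, then polynomials with positive constant coefficient are
positive. -/
theorem mem_of_coeff_zero_pos (h1 : (1 : ℤ[X]) ∈ P) (hX : ∀ n : ℕ, 1 - n • X ∈ P) {f : ℤ[X]}
    (hf : 0 < f.coeff 0) : f ∈ P := by
  have hle : P.linearOrder.le X (1 • 1) := by simpa using hX 1
  -- With `f.coeff 0 = m + 1`, the decomposition is `f = X * (k + f.divX) + (1 - k • X) + m`.
  obtain ⟨k, hk⟩ := exists_le_nsmul_one h1 hle (-f.divX)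
  have hk' : k • (1 : ℤ[X]) - -f.divX ∈ P := hk
  obtain ⟨m, hm⟩ := Int.eq_ofNat_of_zero_le (show 0 ≤ f.coeff 0 - 1 by omega)
  have h := add_mem (add_mem (X_mul_mem_iff.2 hk') (hX k)) (nsmul_mem h1 m)
  convert h using 1
  have hm' : f.coeff 0 = m + 1 := by omega
  conv_lhs => rw [← X_mul_divX_add f, hm']
  simp
  ring

end ShiftCone

/-! ### Values of integer polynomials at real numbers. -/

/-- A polynomial with positive leading coefficient is eventually positive. -/
theorem Polynomial.eventually_aeval_pos_of_leadingCoeff_pos {f : ℤ[X]} (hf : 0 < f.leadingCoeff) :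
    ∀ᶠ t : ℝ in Filter.atTop, 0 < aeval t f := by
  have hinj : Function.Injective (algebraMap ℤ ℝ) := Int.cast_injective
  have hlead : 0 < (f.map (algebraMap ℤ ℝ)).leadingCoeff := by
    rw [leadingCoeff_map_of_injective hinj]
    exact Int.cast_pos.2 hf
  simp_rw [← eval_map_algebraMap]
  by_cases hd : 0 < (f.map (algebraMap ℤ ℝ)).degree
  · exact (tendsto_atTop_of_leadingCoeff_nonneg _ hd hlead.le).eventually_gt_atTop 0
  · rw [eq_C_of_degree_le_zero (not_lt.1 hd)] at hlead ⊢
    rw [leadingCoeff_C] at hlead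
    simp only [eval_C, hlead, Filter.eventually_true]

/-- A real root of a nonzero integer polynomial has an integer polynomial of positive degree
dividing all integer polynomials that vanish there. -/
theorem Polynomial.exists_forall_aeval_eq_zero_iff_dvd {t : ℝ} {g : ℤ[X]} (hg : g ≠ 0)
    (hgt : aeval t g = 0) :
    ∃ m : ℤ[X], 0 < m.natDegree ∧ ∀ q : ℤ[X], aeval t q = 0 ↔ m ∣ q := by
  let I : Ideal ℤ[X] := RingHom.ker (aeval t : ℤ[X] →ₐ[ℤ] ℝ)
  have hI : I.IsPrime := RingHom.ker_isPrime _
  -- A nonzero prime ideal of a factorial ring contains a prime element; it is not constant, as no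
  -- nonzero constant vanishes at `t`.
  obtain ⟨m, hm, hprime⟩ := hI.exists_mem_prime_of_ne_bot
    (fun h => hg (by simpa [h] using (show g ∈ I from hgt)))
  have hmt : aeval t m = 0 := hm
  have hdeg : 0 < m.natDegree := by
    rw [Nat.pos_iff_ne_zero]
    intro h0
    rw [eq_C_of_natDegree_eq_zero h0] at hmt hprime
    refine hprime.ne_zero ?_
    rw [aeval_C] at hmt
    rw [Int.cast_injective (hmt.trans Int.cast_zero.symm), C_0]
  have hprim : m.IsPrimitive := hprime.irreducible.isPrimitive hdeg.ne'
  have hmap : ∀ q : ℤ[X], aeval t (q.map (Int.castRingHom ℚ)) = aeval t q := fun q =>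
    aeval_map_algebraMap ℚ t q
  -- By Gauss's lemma `m` is, up to a scalar, the minimal polynomial of `t` over `ℚ`, and
  -- divisibility by it descends to `ℤ`.
  have hirr : Irreducible (m.map (Int.castRingHom ℚ)) :=
    (IsPrimitive.Int.irreducible_iff_irreducible_map_cast hprim).1 hprime.irreducible
  refine ⟨m, hdeg, fun q => ⟨fun hqt => ?_, ?_⟩⟩
  · rw [IsPrimitive.Int.dvd_iff_map_cast_dvd_map_cast _ _ hprim]
    have h := minpoly.dvd ℚ t ((hmap q).trans hqt)
    rw [← minpoly.eq_of_irreducible hirr ((hmap m).trans hmt)] at h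
    exact (Dvd.intro _ rfl).trans h
  · rintro ⟨h, rfl⟩
    rw [map_mul, hmt, zero_mul]

/-! ### Construction of cones, and absence of isolated points. -/

namespace ShiftCone

/-- The order in which the sign of a polynomial is that of its value at a positive transcendental
number. -/
noncomputable def ofTranscendental {t : ℝ} (ht : 0 < t) (htr : Transcendental ℤ t) : ShiftCone :=
  ofSet {f | 0 ≤ aeval t f}
    (fun f hf g hg => by simpa using add_nonneg hf hg)
    (fun f hf hf' => by
      simp only [Set.mem_ofPred_eq, map_neg, Left.nonneg_neg_iff] at hf hf'
      exact (transcendental_iff.1 htr) f (le_antisymm hf' hf))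
    (fun f => by simpa using le_total 0 (aeval t f))
    (fun f hf => by simpa using mul_nonneg ht.le hf)

/-- The order in which the sign of a polynomial is that of its value at `t`, if nonzero, and
otherwise is the sign in `Q` of its quotient by `m`. -/
noncomputable def lex {t : ℝ} (ht : 0 < t) {m : ℤ[X]} (hm0 : m ≠ 0)
    (hm : ∀ q : ℤ[X], aeval t q = 0 ↔ m ∣ q) (Q : ShiftCone) : ShiftCone :=
  ofSet {f | 0 < aeval t f ∨ ∃ h ∈ Q, f = m * h}
    (by
      have hmt : aeval t m = 0 := (hm m).2 dvd_rfl
      rintro f (hf | ⟨f, hf, rfl⟩) g (hg | ⟨g, hg, rfl⟩)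
      · left
        simpa using add_pos hf hg
      · left
        simpa [hmt] using hf
      · left
        simpa [hmt] using hg
      · exact Or.inr ⟨f + g, add_mem hf hg, (mul_add _ _ _).symm⟩)
    (by
      have hmt : aeval t m = 0 := (hm m).2 dvd_rfl
      rintro f (hf | ⟨f, hf, rfl⟩) (hg | ⟨g, hg, hfg⟩)
      · rw [map_neg] at hg
        linarith
      · rw [neg_eq_iff_eq_neg] at hfg
        simp [hfg, hmt] at hf
      · simp [hmt] at hg
      · rw [← mul_neg] at hfg
        rw [← mul_left_cancel₀ hm0 hfg] at hg
        rw [eq_zero_of_mem_of_neg_mem hf hg, mul_zero])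
    (by
      intro f
      rcases lt_trichotomy (aeval t f) 0 with hf | hf | hf
      · right; left
        simpa using hf
      · obtain ⟨h, rfl⟩ := (hm f).1 hf
        rcases mem_or_neg_mem Q h with hh | hh
        · exact Or.inl (Or.inr ⟨h, hh, rfl⟩)
        · exact Or.inr (Or.inr ⟨-h, hh, (mul_neg _ _).symm⟩)
      · exact Or.inl (Or.inl hf))
    (by
      rintro f (hf | ⟨f, hf, rfl⟩)
      · left
        simpa using mul_pos ht hf
      · exact Or.inr ⟨X * f, X_mul_mem hf, mul_left_comm _ _ _⟩)

theorem mem_lex_of_pos {t : ℝ} {ht : 0 < t} {m : ℤ[X]} {hm0 : m ≠ 0}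
    {hm : ∀ q : ℤ[X], aeval t q = 0 ↔ m ∣ q} {Q : ShiftCone} {f : ℤ[X]} (hf : 0 < aeval t f) :
    f ∈ lex ht hm0 hm Q := Or.inl hf

theorem mul_mem_lex {t : ℝ} {ht : 0 < t} {m : ℤ[X]} {hm0 : m ≠ 0}
    {hm : ∀ q : ℤ[X], aeval t q = 0 ↔ m ∣ q} {Q : ShiftCone} {h : ℤ[X]} :
    m * h ∈ lex ht hm0 hm Q ↔ h ∈ Q := by
  refine ⟨?_, fun hh => Or.inr ⟨h, hh, rfl⟩⟩
  rintro (hf | ⟨h', hh', heq⟩)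
  · rw [map_mul, (hm m).2 dvd_rfl, zero_mul] at hf
    exact absurd hf (lt_irrefl _)
  · rwa [mul_left_cancel₀ hm0 heq]

/-- The order on quotients by `m` of the multiples of `m`. -/
def divide (P : ShiftCone) {m : ℤ[X]} (hm0 : m ≠ 0) : ShiftCone :=
  ofSet {h | m * h ∈ P}
    (fun f hf g hg => by simpa [mul_add] using add_mem (S := ShiftCone) hf hg)
    (fun f hf hf' => by
      refine (mul_eq_zero.1 (eq_zero_of_mem_of_neg_mem (C := P) hf ?_)).resolve_left hm0
      simpa using hf')
    (fun f => by simpa using mem_or_neg_mem P (m * f))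
    (fun f hf => by simpa [mul_left_comm] using X_mul_mem (P := P) hf)

@[simp]
theorem mem_divide {P : ShiftCone} {m : ℤ[X]} {hm0 : m ≠ 0} {h : ℤ[X]} :
    h ∈ P.divide hm0 ↔ m * h ∈ P := Iff.rfl

variable {ι : Type*}

/-- Polynomials that are positive on an interval of positive numbers are nonnegative in two
different orders. -/
theorem exists_ne_of_interval {a b : ℝ} (ha : 0 ≤ a) (hab : a < b) {s : Finset ι} {g : ι → ℤ[X]}
    (hg : ∀ t ∈ Set.Ioo a b, ∀ i ∈ s, 0 < aeval t (g i)) :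
    ∃ Q Q' : ShiftCone, Q ≠ Q' ∧ ∀ i ∈ s, g i ∈ Q ∧ g i ∈ Q' := by
  have hdense : Dense {x : ℝ | IsAlgebraic ℤ x}ᶜ :=
    (Algebraic.countable ℤ ℝ).dense_compl ℝ
  obtain ⟨t, ht, hat, htb⟩ := hdense.exists_between hab
  obtain ⟨t', ht', htt', htb'⟩ := hdense.exists_between htb
  obtain ⟨q, hq, hq'⟩ := exists_rat_btwn htt'
  refine ⟨ofTranscendental (ha.trans_lt hat) ht,
    ofTranscendental (ha.trans_lt (hat.trans htt')) ht', fun h => ?_, fun i hi =>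
    ⟨(hg t ⟨hat, htb⟩ i hi).le, (hg t' ⟨hat.trans htt', htb'⟩ i hi).le⟩⟩
  -- This linear polynomial has its root `q` between `t` and `t'`, so its signs there differ.
  have hmem : 0 ≤ aeval t (C (q.den : ℤ) * X - C q.num) ↔
      0 ≤ aeval t' (C (q.den : ℤ) * X - C q.num) := SetLike.ext_iff.1 h _
  have hden : (0 : ℝ) < q.den := by exact_mod_cast q.den_pos
  have hqeq : (q : ℝ) = q.num / q.den := by exact_mod_cast (Rat.num_div_den q).symm
  rw [hqeq, lt_div_iff₀ hden] at hq
  rw [hqeq, div_lt_iff₀ hden] at hq'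
  simp only [map_sub, map_mul, aeval_X, aeval_C, algebraMap_int_eq, Int.coe_castRingHom,
    Int.cast_natCast] at hmem
  have := hmem.2 (by linarith)
  linarith

/-- Nonzero polynomials that are nonnegative in an order with `0 ≤ 1` are all positive on some
interval of positive numbers, or all nonnegative at some positive number. -/
theorem exists_interval_or_exists_nonneg {P : ShiftCone} (h1 : (1 : ℤ[X]) ∈ P) {s : Finset ι}
    {g : ι → ℤ[X]} (hg0 : ∀ i ∈ s, g i ≠ 0) (hg : ∀ i ∈ s, g i ∈ P) :
    (∃ a b : ℝ, 0 ≤ a ∧ a < b ∧ ∀ t ∈ Set.Ioo a b, ∀ i ∈ s, 0 < aeval t (g i)) ∨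
      ∃ t : ℝ, 0 < t ∧ ∀ i ∈ s, 0 ≤ aeval t (g i) := by
  by_cases hlarge : ∀ n : ℕ, X - n • 1 ∈ P
  · left
    have hev : ∀ i ∈ s, ∀ᶠ t : ℝ in Filter.atTop, 0 < aeval t (g i) := by
      intro i hi
      refine eventually_aeval_pos_of_leadingCoeff_pos ?_
      by_contra! hle
      have hlt : (g i).leadingCoeff < 0 :=
        lt_of_le_of_ne hle (leadingCoeff_ne_zero.2 (hg0 i hi))
      have hneg : -g i ∈ P := mem_of_leadingCoeff_pos h1 hlarge (by simpa using hlt)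
      exact hg0 i hi (eq_zero_of_mem_of_neg_mem (hg i hi) hneg)
    obtain ⟨a, ha⟩ := Filter.eventually_atTop.1 ((Filter.eventually_all_finset s).2 hev)
    exact ⟨max a 0, max a 0 + 1, le_max_right _ _, lt_add_one _, fun t ht =>
      ha t ((le_max_left _ _).trans ht.1.le)⟩
  by_cases hsmall : ∀ n : ℕ, 1 - n • X ∈ P
  · left
    have hev : ∀ i ∈ s, ∀ᶠ t : ℝ in nhdsWithin 0 (Set.Ioi 0), 0 < aeval t (g i) := by
      intro i hi
      -- Splitting off the power of `X` leaves a nonzero constant coefficient, whose sign decides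
      -- both in `P` and near `0`.
      obtain ⟨q, hq, hdvd⟩ := exists_eq_pow_rootMultiplicity_mul_and_not_dvd _ (hg0 i hi) 0
      rw [C_0, sub_zero] at hq hdvd
      rw [X_dvd_iff] at hdvd
      have hmem : q ∈ P := by
        rw [← X_pow_mul_mem_iff, ← hq]
        exact hg i hi
      have hpos : 0 < q.coeff 0 := by
        by_contra! hle
        have hneg : -q ∈ P :=
          mem_of_coeff_zero_pos h1 hsmall (by simpa using lt_of_le_of_ne hle hdvd)
        exact hdvd (by rw [eq_zero_of_mem_of_neg_mem hmem hneg, coeff_zero])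
      have hcont : ∀ᶠ t : ℝ in nhds 0, 0 < aeval t q := by
        refine (Polynomial.continuous_aeval q).continuousAt.eventually (lt_mem_nhds ?_)
        change 0 < aeval (0 : ℝ) q
        rw [← coeff_zero_eq_aeval_zero']
        exact Int.cast_pos.2 hpos
      filter_upwards [self_mem_nhdsWithin, nhdsWithin_le_nhds hcont] with t ht htq
      rw [hq, map_mul, map_pow, aeval_X]
      exact mul_pos (pow_pos ht _) htq
    obtain ⟨b, hb, hb'⟩ := mem_nhdsGT_iff_exists_Ioo_subset.1
      ((Filter.eventually_all_finset s).2 hev)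
    exact ⟨0, b, le_rfl, hb, fun t ht => hb' ht⟩
  · right
    push Not at hlarge hsmall
    obtain ⟨n, hn⟩ := hlarge
    obtain ⟨k, hk⟩ := hsmall
    have hswap : ∀ f g : ℤ[X], f - g ∉ P → g - f ∈ P := fun f g h => by
      simpa using (mem_or_neg_mem P (f - g)).resolve_left h
    -- From `X ≤ n` and `1 ≤ k • X`, the single constant `n + k` serves both comparisons.
    have hn' : (n + k) • (1 : ℤ[X]) - X ∈ P := by
      have := add_mem (hswap _ _ hn) (nsmul_mem h1 k)
      convert this using 1
      rw [add_nsmul]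
      ring
    have hk' : (n + k) • (X : ℤ[X]) - 1 ∈ P := by
      have hX : (X : ℤ[X]) ∈ P := by simpa using X_mul_mem h1
      have := add_mem (hswap _ _ hk) (nsmul_mem hX n)
      convert this using 1
      rw [add_nsmul]
      ring
    obtain ⟨t, ht, htP⟩ := exists_forall_aeval_nonneg h1 hn' hk'
    exact ⟨t, ht, fun i hi => htP _ (hg i hi)⟩

/-- Finitely many nonzero polynomials that are nonnegative in some order are nonnegative in two
different orders. -/
theorem exists_ne_forall_mem (P : ShiftCone) {s : Finset ι} {g : ι → ℤ[X]}
    (hg0 : ∀ i ∈ s, g i ≠ 0) (hg : ∀ i ∈ s, g i ∈ P) :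
    ∃ Q Q' : ShiftCone, Q ≠ Q' ∧ ∀ i ∈ s, g i ∈ Q ∧ g i ∈ Q' := by
  induction hd : ∑ i ∈ s, (g i).natDegree using Nat.strong_induction_on generalizing P s g with
  | _ d ih =>
  -- Reversing the order and negating all the polynomials preserves their degrees.
  wlog h1 : (1 : ℤ[X]) ∈ P generalizing P g with H
  · obtain ⟨Q, Q', hne, hQ⟩ := H P.neg (g := fun i => -g i) (fun i hi => neg_ne_zero.2 (hg0 i hi))
      (fun i hi => by simpa using hg i hi) (by simpa using hd)
      ((mem_or_neg_mem P 1).resolve_left h1)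
    refine ⟨Q.neg, Q'.neg, fun h => hne (SetLike.ext fun f => ?_), hQ⟩
    simpa using SetLike.ext_iff.1 h (-f)
  rcases exists_interval_or_exists_nonneg h1 hg0 hg with ⟨a, b, ha, hab, h⟩ | ⟨t, ht, hpos⟩
  · exact exists_ne_of_interval ha hab h
  by_cases hall : ∀ i ∈ s, 0 < aeval t (g i)
  · have hev : ∀ᶠ t' : ℝ in nhds t, 0 < t' ∧ ∀ i ∈ s, 0 < aeval t' (g i) :=
      (lt_mem_nhds ht).and ((Filter.eventually_all_finset s).2 fun i hi =>
        (Polynomial.continuous_aeval (g i)).continuousAt.eventually (lt_mem_nhds (hall i hi)))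
    obtain ⟨a, b, htab, hsub⟩ := mem_nhds_iff_exists_Ioo_subset.1 hev
    exact exists_ne_of_interval ht.le htab.2 fun t' ht' => (hsub ⟨htab.1.trans ht'.1, ht'.2⟩).2
  push Not at hall
  obtain ⟨j, hj, hjt⟩ := hall
  obtain ⟨m, hdeg, hm⟩ :=
    exists_forall_aeval_eq_zero_iff_dvd (hg0 j hj) (le_antisymm hjt (hpos j hj))
  have hm0 : m ≠ 0 := by
    rintro rfl
    simp at hdeg
  classical
  have hdiv : ∀ i, ∃ h, aeval t (g i) = 0 → g i = m * h := fun i => by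
    by_cases hi : aeval t (g i) = 0
    · obtain ⟨h, hh⟩ := (hm _).1 hi
      exact ⟨h, fun _ => hh⟩
    · exact ⟨0, fun h => absurd h hi⟩
  choose h hh using hdiv
  let s' := s.filter fun i => aeval t (g i) = 0
  have hs' : ∀ i ∈ s', i ∈ s ∧ g i = m * h i := fun i hi =>
    ⟨(Finset.mem_filter.1 hi).1, hh i (Finset.mem_filter.1 hi).2⟩
  have hh0 : ∀ i ∈ s', h i ≠ 0 := fun i hi h0 =>
    hg0 i (hs' i hi).1 (by rw [(hs' i hi).2, h0, mul_zero])
  -- Each division by `m` lowers the degree, and `j` belongs to `s'`, so the sum drops strictly.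
  have hlt : ∑ i ∈ s', (h i).natDegree < d := by
    rw [← hd]
    refine lt_of_lt_of_le (Finset.sum_lt_sum_of_nonempty (g := fun i => (g i).natDegree)
      ⟨j, Finset.mem_filter.2 ⟨hj, le_antisymm hjt (hpos j hj)⟩⟩ fun i hi => ?_)
      (Finset.sum_le_sum_of_subset (Finset.filter_subset _ s))
    rw [(hs' i hi).2, natDegree_mul hm0 (hh0 i hi)]
    omega
  obtain ⟨Q, Q', hne, hQ⟩ := ih _ hlt (P.divide hm0) hh0
    (fun i hi => by rw [mem_divide, ← (hs' i hi).2]; exact hg i (hs' i hi).1) rfl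
  -- Both lexicographic orders agree off the multiples of `m`; on these they recover `Q` and `Q'`,
  -- hence differ.
  refine ⟨lex ht hm0 hm Q, lex ht hm0 hm Q', fun heq => hne (SetLike.ext fun f => ?_),
    fun i hi => ?_⟩
  · simpa only [mul_mem_lex] using SetLike.ext_iff.1 heq (m * f)
  · rcases (hpos i hi).eq_or_lt with h0 | hlt
    · have hi' : i ∈ s' := Finset.mem_filter.2 ⟨hi, h0.symm⟩
      rw [(hs' i hi').2, mul_mem_lex, mul_mem_lex]
      exact hQ i hi'
    · exact ⟨mem_lex_of_pos hlt, mem_lex_of_pos hlt⟩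

theorem nonempty : Nonempty ShiftCone := by
  obtain ⟨Q, -⟩ := exists_ne_of_interval (ι := Empty) (s := ∅) (g := Empty.elim) le_rfl
    zero_lt_one (by simp)
  exact ⟨Q⟩

end ShiftCone

/-! ### Topology of the space of invariant orders. -/

namespace InvariantOrder

section General

variable {Q A : Type*} [Group Q] [AddCommGroup A] [DistribMulAction Q A]

theorem le_iff_nonneg_sub (o : InvariantOrder Q A) {a b : A} : o.le a b ↔ o.le 0 (b - a) := by
  refine ⟨fun h => ?_, fun h => ?_⟩
  · simpa [sub_eq_add_neg] using o.add_le_add_right _ _ h (-a)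
  · simpa using o.add_le_add_right _ _ h a

theorem nonneg_add (o : InvariantOrder Q A) {a b : A} (ha : o.le 0 a) (hb : o.le 0 b) :
    o.le 0 (a + b) :=
  o.le_trans _ _ _ hb (by simpa using o.add_le_add_right _ _ ha b)

theorem nonneg_or_nonneg_neg (o : InvariantOrder Q A) (a : A) : o.le 0 a ∨ o.le 0 (-a) := by
  simpa [o.le_iff_nonneg_sub (a := a) (b := 0)] using o.le_total 0 a

theorem eq_zero_of_nonneg_of_nonneg_neg (o : InvariantOrder Q A) {a : A} (ha : o.le 0 a)
    (ha' : o.le 0 (-a)) : a = 0 :=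
  o.le_antisymm _ _ (o.le_iff_nonneg_sub.2 (by simpa using ha')) ha

theorem nonneg_smul_iff (o : InvariantOrder Q A) (q : Q) {a : A} :
    o.le 0 (q • a) ↔ o.le 0 a := by
  refine ⟨fun h => ?_, fun h => ?_⟩
  · simpa using o.smul_le_smul _ _ h q⁻¹
  · simpa using o.smul_le_smul _ _ h q

theorem ext_nonneg {o o' : InvariantOrder Q A} (h : ∀ a, o.le 0 a ↔ o'.le 0 a) : o = o' := by
  ext a b
  rw [o.le_iff_nonneg_sub, o'.le_iff_nonneg_sub, h]

/-- The invariant order with a given set of nonnegative elements. -/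
def ofNonneg (S : Set A) (hadd : ∀ f ∈ S, ∀ g ∈ S, f + g ∈ S) (hanti : ∀ f ∈ S, -f ∈ S → f = 0)
    (htotal : ∀ f, f ∈ S ∨ -f ∈ S) (hsmul : ∀ (q : Q), ∀ f ∈ S, q • f ∈ S) :
    InvariantOrder Q A where
  le a b := b - a ∈ S
  le_refl a := by simpa using htotal 0
  le_trans a b c hab hbc := by simpa using hadd _ hbc _ hab
  le_antisymm a b hab hba := (sub_eq_zero.1 (hanti _ hab (by simpa using hba))).symm
  le_total a b := by simpa using htotal (b - a)
  add_le_add_right a b hab c := by simpa using hab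
  smul_le_smul a b hab q := by
    rw [← smul_sub]
    exact hsmul q _ hab

theorem ofNonneg_nonneg_iff {S : Set A} {hadd hanti htotal}
    {hsmul : ∀ (q : Q), ∀ f ∈ S, q • f ∈ S} {f : A} :
    (ofNonneg S hadd hanti htotal hsmul).le 0 f ↔ f ∈ S := by
  change f - 0 ∈ S ↔ _
  rw [sub_zero]

/-- For `g ≠ 0` the complement is the sub-basic set of `-g`; for `g = 0` it is empty. -/
theorem isClopen_setOf_nonneg (g : A) : IsClopen {o : InvariantOrder Q A | o.le 0 g} := by
  have hopen : ∀ g : A, IsOpen {o : InvariantOrder Q A | o.le 0 g} := fun g =>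
    TopologicalSpace.isOpen_generateFrom_of_mem ⟨g, rfl⟩
  refine ⟨⟨?_⟩, hopen g⟩
  by_cases hg : g = 0
  · convert isOpen_empty
    refine Set.eq_empty_of_forall_notMem fun o ho => ho ?_
    rw [hg]
    exact o.le_refl 0
  · convert hopen (-g)
    ext o
    exact ⟨fun h => (o.nonneg_or_nonneg_neg g).resolve_left h,
      fun h h' => hg (o.eq_zero_of_nonneg_of_nonneg_neg h' h)⟩

theorem exists_not_nonneg_iff {o o' : InvariantOrder Q A} (h : o ≠ o') :
    ∃ a, ¬ (o.le 0 a ↔ o'.le 0 a) := by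
  by_contra! h'
  exact h (ext_nonneg h')

instance : T2Space (InvariantOrder Q A) where
  t2 o o' hne := by
    obtain ⟨a, ha⟩ := exists_not_nonneg_iff hne
    have hV := isClopen_setOf_nonneg (Q := Q) a
    by_cases h : o.le 0 a
    · exact ⟨_, _, hV.isOpen, hV.compl.isOpen, h, fun h' => ha ⟨fun _ => h', fun _ => h⟩,
        disjoint_compl_right⟩
    · exact ⟨_, _, hV.compl.isOpen, hV.isOpen, h, by_contra fun h' => ha
        ⟨fun h'' => absurd h'' h, fun h'' => absurd h'' h'⟩, disjoint_compl_left⟩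

/-- The limit of an ultrafilter of invariant orders. -/
def ultrafilterLimit (F : Ultrafilter (InvariantOrder Q A)) : InvariantOrder Q A where
  le a b := ∀ᶠ o : InvariantOrder Q A in F, o.le a b
  le_refl a := Filter.Eventually.of_forall fun o => o.le_refl a
  le_trans a b c hab hbc := by
    filter_upwards [hab, hbc] with o h h' using o.le_trans _ _ _ h h'
  le_antisymm a b hab hba := by
    obtain ⟨o, h, h'⟩ := (hab.and hba).exists
    exact o.le_antisymm _ _ h h'
  le_total a b := Ultrafilter.eventually_or.1 (Filter.Eventually.of_forall fun o => o.le_total a b)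
  add_le_add_right a b hab c := by
    filter_upwards [hab] with o h using o.add_le_add_right _ _ h c
  smul_le_smul a b hab q := by
    filter_upwards [hab] with o h using o.smul_le_smul _ _ h q

/-- Every ultrafilter converges to its limit order, because convergence need only be tested on the
sub-basis. -/
instance : CompactSpace (InvariantOrder Q A) where
  isCompact_univ := by
    refine isCompact_iff_ultrafilter_le_nhds.2 fun F _ => ⟨ultrafilterLimit F, trivial, ?_⟩
    rw [TopologicalSpace.nhds_generateFrom]
    refine le_iInf₂ fun s hs => Filter.le_principal_iff.2 ?_
    obtain ⟨hmem, g, rfl⟩ := hs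
    exact show ∀ᶠ o : InvariantOrder Q A in F, o.le 0 g from hmem

/-- The space of invariant orders is a Cantor set if it is nonempty and no finite set of elements
that are nonnegative in one order determines that order. -/
theorem nonempty_homeomorph_cantorSet [Countable A] [Nonempty (InvariantOrder Q A)]
    (h : ∀ (o : InvariantOrder Q A) (s : Finset A), (∀ g ∈ s, o.le 0 g) →
      ∃ o₁ o₂ : InvariantOrder Q A, o₁ ≠ o₂ ∧ ∀ g ∈ s, o₁.le 0 g ∧ o₂.le 0 g) :
    Nonempty (InvariantOrder Q A ≃ₜ cantorSet) := by
  obtain ⟨e, he⟩ := exists_surjective_nat A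
  obtain ⟨Φ⟩ := nonempty_homeomorph_nat_bool (K := InvariantOrder Q A)
    (U := fun n => {o | o.le 0 (e n)}) (fun n => isClopen_setOf_nonneg (e n))
    (fun o o' hne => by
      obtain ⟨a, ha⟩ := exists_not_nonneg_iff hne
      obtain ⟨n, rfl⟩ := he a
      exact ⟨n, ha⟩)
    (fun W hW ⟨o, ho⟩ => by
      -- A basic neighbourhood of `o` imposes finitely many conditions `0 ≤ g`, so `h` puts two
      -- orders in it.
      obtain ⟨_, ⟨f, ⟨hfin, hsub⟩, rfl⟩, hof, hfW⟩ :=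
        (TopologicalSpace.isTopologicalBasis_of_subbasis rfl).exists_subset_of_mem_open ho hW
      choose! g hg using hsub
      classical
      obtain ⟨o₁, o₂, hne, hmem⟩ := h o (hfin.toFinset.image g) (by
        simp only [Finset.mem_image, Set.Finite.mem_toFinset]
        rintro _ ⟨V, hV, rfl⟩
        have := hof V hV
        rwa [← hg hV] at this)
      have hV : ∀ V ∈ f, o₁ ∈ V ∧ o₂ ∈ V := fun V hV => by
        rw [← hg hV]
        exact hmem _ (Finset.mem_image_of_mem g (hfin.mem_toFinset.2 hV))
      exact ⟨o₁, hfW fun V h => (hV V h).1, o₂, hfW fun V h => (hV V h).2, hne⟩)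
  exact ⟨Φ.symm.trans cantorSetHomeomorphNatToBool.symm⟩

end General

end InvariantOrder

/-! ### Passage between polynomials and Laurent polynomials. -/

open LaurentPolynomial

theorem laurentX_zpow (k : ℤ) : ((laurentX ^ k : (ℤ[T;T⁻¹])ˣ) : ℤ[T;T⁻¹]) = T k := by
  obtain ⟨n, rfl | rfl⟩ := k.eq_nat_or_neg
  · rw [zpow_natCast, Units.val_pow_eq_pow_val]
    change (T 1 : ℤ[T;T⁻¹]) ^ n = T n
    rw [T_pow, mul_one]
  · rw [zpow_neg, zpow_natCast, ← inv_pow, Units.val_pow_eq_pow_val]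
    change (T (-1) : ℤ[T;T⁻¹]) ^ n = T (-n)
    rw [T_pow, mul_neg, mul_one]

namespace ShiftCone

variable (P : ShiftCone)

/-- The Laurent polynomials which are a product of an element of `P` and a power of `T`. -/
def laurentNonneg : Set ℤ[T;T⁻¹] := {f | ∃ n : ℕ, ∃ q ∈ P, f * T n = toLaurent q}

variable {P}

/-- Two ways of clearing denominators differ by powers of `X`, which do not affect membership in
`P`. -/
theorem mem_laurentNonneg_iff {f : ℤ[T;T⁻¹]} {n : ℕ} {q : ℤ[X]} (h : f * T n = toLaurent q) :
    f ∈ P.laurentNonneg ↔ q ∈ P := by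
  refine ⟨?_, fun hq => ⟨n, q, hq, h⟩⟩
  rintro ⟨k, r, hr, hrf⟩
  have heq : X ^ k * q = X ^ n * r := by
    apply toLaurent_injective
    rw [map_mul, map_mul, toLaurent_X_pow, toLaurent_X_pow, ← h, ← hrf]
    ring
  rwa [← X_pow_mul_mem_iff k, heq, X_pow_mul_mem_iff]

variable (P) in
/-- The invariant order on Laurent polynomials given by a cone of polynomials. -/
noncomputable def toInvariantOrder : InvariantOrder (Subgroup.zpowers laurentX) ℤ[T;T⁻¹] :=
  InvariantOrder.ofNonneg P.laurentNonneg
    (by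
      rintro f ⟨n, q, hq, hf⟩ g ⟨k, r, hr, hg⟩
      refine ⟨n + k, X ^ k * q + X ^ n * r,
        add_mem ((X_pow_mul_mem_iff k).2 hq) ((X_pow_mul_mem_iff n).2 hr), ?_⟩
      rw [map_add, map_mul, map_mul, toLaurent_X_pow, toLaurent_X_pow, ← hf, ← hg, Nat.cast_add,
        T_add]
      ring)
    (by
      rintro f ⟨n, q, hq, hf⟩ hneg
      have hq' : -q ∈ P := (mem_laurentNonneg_iff (n := n) (by
        rw [neg_mul, hf, map_neg])).1 hneg
      rw [eq_zero_of_mem_of_neg_mem hq hq', map_zero] at hf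
      exact (mul_eq_zero.1 hf).resolve_right (isUnit_T _).ne_zero)
    (by
      intro f
      obtain ⟨n, q, hq⟩ := f.exists_T_pow
      refine (mem_or_neg_mem P q).imp (fun h => ⟨n, q, h, hq.symm⟩) fun h => ⟨n, -q, h, ?_⟩
      rw [neg_mul, ← hq, map_neg])
    (by
      rintro ⟨_, k, rfl⟩ f ⟨n, q, hq, hf⟩
      -- Since `k` may be negative, the extra factor `T |k|` keeps the exponent nonnegative.
      refine ⟨n + k.natAbs, X ^ (k + k.natAbs).toNat * q, (X_pow_mul_mem_iff _).2 hq, ?_⟩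
      change ((laurentX ^ k : (ℤ[T;T⁻¹])ˣ) : ℤ[T;T⁻¹]) * f * _ = _
      rw [laurentX_zpow, map_mul, toLaurent_X_pow, ← hf, Int.toNat_of_nonneg (by omega), T_add,
        Nat.cast_add, T_add]
      ring)

theorem toInvariantOrder_nonneg_iff {f : ℤ[T;T⁻¹]} {n : ℕ} {q : ℤ[X]}
    (h : f * T n = toLaurent q) : P.toInvariantOrder.le 0 f ↔ q ∈ P :=
  InvariantOrder.ofNonneg_nonneg_iff.trans (mem_laurentNonneg_iff h)

theorem toInvariantOrder_injective : Function.Injective toInvariantOrder := by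
  intro P Q h
  refine SetLike.ext fun q => ?_
  have hq : toLaurent q * T (0 : ℕ) = toLaurent q := by simp
  rw [← toInvariantOrder_nonneg_iff hq, h, toInvariantOrder_nonneg_iff hq]

end ShiftCone

namespace InvariantOrder

theorem nonneg_mul_T_iff (o : InvariantOrder (Subgroup.zpowers laurentX) ℤ[T;T⁻¹])
    {f : ℤ[T;T⁻¹]} (k : ℤ) : o.le 0 (f * T k) ↔ o.le 0 f := by
  rw [← o.nonneg_smul_iff ⟨laurentX ^ k, k, rfl⟩ (a := f), mul_comm, ← laurentX_zpow]
  rfl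

/-- The cone of polynomials that are nonnegative in an invariant order on Laurent polynomials. -/
noncomputable def toShiftCone (o : InvariantOrder (Subgroup.zpowers laurentX) ℤ[T;T⁻¹]) :
    ShiftCone :=
  ShiftCone.ofSet {f | o.le 0 (toLaurent f)}
    (fun f hf g hg => by simpa using o.nonneg_add hf hg)
    (fun f hf hf' => toLaurent_eq_zero.1 (o.eq_zero_of_nonneg_of_nonneg_neg hf (by simpa using hf')))
    (fun f => by simpa using o.nonneg_or_nonneg_neg (toLaurent f))
    (fun f hf => by
      rw [Set.mem_ofPred_eq, map_mul, toLaurent_X, mul_comm, o.nonneg_mul_T_iff]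
      exact hf)

theorem mem_toShiftCone {o : InvariantOrder (Subgroup.zpowers laurentX) ℤ[T;T⁻¹]} {f : ℤ[X]} :
    f ∈ o.toShiftCone ↔ o.le 0 (toLaurent f) := Iff.rfl

/-- Powers of `T` clear denominators without changing signs; the zero element is set aside, being
nonnegative in every order. -/
theorem exists_ne_forall_nonneg (o : InvariantOrder (Subgroup.zpowers laurentX) ℤ[T;T⁻¹])
    (s : Finset ℤ[T;T⁻¹]) (hs : ∀ g ∈ s, o.le 0 g) :
    ∃ o₁ o₂ : InvariantOrder (Subgroup.zpowers laurentX) ℤ[T;T⁻¹],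
      o₁ ≠ o₂ ∧ ∀ g ∈ s, o₁.le 0 g ∧ o₂.le 0 g := by
  classical
  choose n p hp using LaurentPolynomial.exists_T_pow (R := ℤ)
  obtain ⟨Q, Q', hne, hQ⟩ := ShiftCone.exists_ne_forall_mem o.toShiftCone
    (s := s.filter (· ≠ 0)) (g := p)
    (fun g hg h0 => by
      have h := hp g
      rw [h0, map_zero] at h
      exact (Finset.mem_filter.1 hg).2
        ((mul_eq_zero.1 h.symm).resolve_right (isUnit_T _).ne_zero))
    (fun g hg => by
      rw [mem_toShiftCone, hp, o.nonneg_mul_T_iff]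
      exact hs g (Finset.mem_filter.1 hg).1)
  refine ⟨Q.toInvariantOrder, Q'.toInvariantOrder,
    ShiftCone.toInvariantOrder_injective.ne hne, fun g hg => ?_⟩
  by_cases h0 : g = 0
  · rw [h0]
    exact ⟨InvariantOrder.le_refl _ 0, InvariantOrder.le_refl _ 0⟩
  · rw [ShiftCone.toInvariantOrder_nonneg_iff (hp g).symm,
      ShiftCone.toInvariantOrder_nonneg_iff (hp g).symm]
    exact hQ g (Finset.mem_filter.2 ⟨hg, h0⟩)

end InvariantOrder

theorem LaurentPolynomial.countable_int : Countable ℤ[T;T⁻¹] := by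
  have : Countable ℤ[X] := Cardinal.mk_le_aleph0_iff.1
    (Polynomial.cardinalMk_le_max.trans (max_le Cardinal.mk_le_aleph0 le_rfl))
  choose n p hp using LaurentPolynomial.exists_T_pow (R := ℤ)
  refine Function.Injective.countable (f := fun f => (n f, p f)) fun f g h => ?_
  obtain ⟨h1, h2⟩ := Prod.mk.inj h
  refine (isUnit_T (R := ℤ) (n f : ℤ)).mul_right_cancel ?_
  rw [← hp, h2, hp, h1]

/-- The space of `⟨x⟩`-invariant orders on `ℤ[x, x⁻¹]` is homeomorphic to the Cantor set, where
the cyclic group `⟨x⟩` of units of `ℤ[x, x⁻¹]` acts on `ℤ[x, x⁻¹]` by multiplication. -/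
theorem mainTheorem9 :
    Nonempty
      (InvariantOrder (Subgroup.zpowers laurentX) (LaurentPolynomial ℤ) ≃ₜ cantorSet) := by
  have := LaurentPolynomial.countable_int
  have : Nonempty (InvariantOrder (Subgroup.zpowers laurentX) (LaurentPolynomial ℤ)) :=
    ShiftCone.nonempty.map ShiftCone.toInvariantOrder
  exact InvariantOrder.nonempty_homeomorph_cantorSet InvariantOrder.exists_ne_forall_nonneg
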